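/- **Setting.** Let $q$ be a power of a prime, $A=\mathbb F_q[\theta]$, $K_\infty=\mathbb F_q((1/\theta))$ with $|\theta|_\infty=q$, and let $\mathbb C_\infty$ be the completion of an algebraic closure of $K_\infty$. Let $\mathbb T\subset\mathbb C_\infty[[t]]$ be the Tate algebra of power series $\sum_i a_it^i$ with $a_i\to0$. For $f=\sum a_it^i$ put $f^{(1)}=\sum a_i^qt^i$ and $\wp(f)=f-f^{(1)}$. Fix a $(q-1)$-th root $(-\theta)^{1/(q-1)}$ of $-\theta$ in $\mathbb C_\infty$ and put $$\Omega(t)=(-\theta)^{-q/(q-1)}\prod_{i\ge1}\Bigl(1-\frac t{\theta^{q^i}}\Bigr),\qquad \tilde\pi=\frac1{\Omega(\theta)} .$$ **Systems.** Let $d\ge 0$ and $Z_1,\dots,Z_d\in\mathbb T$. A *solution for* $(Z_1,\dots,Z_d)$ is a vector $(f_1,\dots,f_d)^{\mathtt T}\in\mathbb T^d$ with $\wp(f_i)=Z_{d-i+1}\,f_{i-1}^{(1)}$ for $1\le i\le d$, where $f_0=1$. A *star solution for* $(Z_1,\dots,Z_d)$ is a vector $(g_d,\dots,g_1)^{\mathtt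 T}\in\mathbb T^d$ with $\wp(g_i)=Z_{d-i+1}\,g_{i-1}$ for $1\le i\le d$, where $g_0=1$. **Classes and monodromy modules.** Let $d\ge1$, $n_1,\dots,n_d\ge1$, $N=n_1+\cdots+n_d$ and $z_1,\dots,z_{d-1}\in\mathbb C_\infty$. Let $\mathbb M$ (resp. $\mathbb M^\star$) be the $\mathbb F_q[t]$-submodule of $\mathbb T^d$ generated by the vectors $$\Omega^{-N}(0,\dots,0,1,f_1,\dots,f_k)^{\mathtt T}\qquad\bigl(\text{resp. }\ \Omega^{-N}(g_k,\dots,g_1,1,0,\dots,0)^{\mathtt T}\bigr),\qquad 0\le k\le d-1,$$ where $(f_1,\dots,f_k)$ (resp. $(g_k,\dots,g_1)$) runs over the solutions (resp. star solutions) for $(\Omega^{n_1}z_1,\dots,\Omega^{n_k}z_k)$. The monodromy module $M_{n_1,\dots,n_d}^{z_1,\dots,z_{d-1}}$ (resp. $M_{n_1,\dots,n_d}^{\star,z_1,\dots,z_{d-1}}$) is the $A$-submodule of $\mathbb C_\infty^d$ obtained from $\mathbb M$ (resp. $\mathbb M^\star$) by the substitution $t=\theta$. For $z_d\in\mathbb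 C_\infty$, the class $$\vec{\mathrm{Li}}_{n_1,\dots,n_d}(z_1,\dots,z_d)\in\mathbb C_\infty^d/M_{n_1,\dots,n_d}^{z_1,\dots,z_{d-1}}\qquad\bigl(\text{resp. }\ \vec{\mathrm{Li}}^{\star}_{n_1,\dots,n_d}(z_1,\dots,z_d)\in\mathbb C_\infty^d/M_{n_1,\dots,n_d}^{\star,z_1,\dots,z_{d-1}}\bigr)$$ is the class of the value at $t=\theta$ of $\Omega^{-N}f$, where $f$ is a solution (resp. star solution) for $(\Omega^{n_1}z_1,\dots,\Omega^{n_d}z_d)$. A *branch* $\vec{\mathrm{Li}}^{o}_{n_1,\dots,n_d}(z_1,\dots,z_{d-1},-):\mathbb C_\infty\to\mathbb C_\infty^d$ (resp. $\vec{\mathrm{Li}}^{\star,o}_{n_1,\dots,n_d}(z_1,\dots,z_{d-1},-)$) is an $\mathbb F_q$-linear lift of the map $z_d\mapsto\vec{\mathrm{Li}}_{n_1,\dots,n_d}(z_1,\dots,z_d)$ (resp. $z_d\mapsto\vec{\mathrm{Li}}^{\star}_{n_1,\dots,n_d}(z_1,\dots,z_d)$). **Corollary.** Let $d\ge 1$,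 $n_1,\dots,n_d\ge1$, $N=n_1+\cdots+n_d$ and $z_1,\dots,z_d\in\mathbb C_\infty$. Let $\vec{\mathrm{Li}}^{o}_{n_1,\dots,n_d}(z_1,\dots,z_d)$ be the value at $z_d$ of any branch $\vec{\mathrm{Li}}^{o}_{n_1,\dots,n_d}(z_1,\dots,z_{d-1},-)$, and let $\vec{\mathrm{Li}}^{\star,o}_{n_d,\dots,n_1}(z_d,\dots,z_1)=(v_d,v_{d-1},\dots,v_1)^{\mathtt T}$ be the value at $z_1$ of any branch $\vec{\mathrm{Li}}^{\star,o}_{n_d,\dots,n_1}(z_d,\dots,z_2,-)$. Put $$\vec{\mathrm{Li}}^{\star,o}_{n_d,\dots,n_1}(-z_d,\dots,-z_1):=\bigl((-1)^dv_d,(-1)^{d-1}v_{d-1},\dots,-v_1\bigr)^{\mathtt T}.$$ Then $$\begin{pmatrix}\vec{\mathrm{Li}}^{\star,o}_{n_d,\dots,n_1}(-z_d,\dots,-z_1)\\ \tilde\pi^{N}\end{pmatrix}^{\mathtt T}\cdot\begin{pmatrix}\tilde\pi^{N}\\ \vec{\mathrm{Li}}^{o}_{n_1,\dots,n_d}(z_1,\dots,z_d)\end{pmatrix}\equiv0\pmod{\tilde\pi^{2N}A}.$$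 -/

import Mathlib

open Filter Topology PowerSeries
open scoped WithZero NNReal

/-! ## The fields `K_∞` and `ℂ_∞` -/

/-- `K_∞ = 𝔽_q((1/θ))`, the completion of `K = 𝔽_q(θ)` at the infinite place. -/
abbrev KInfty (Fq : Type*) [Field Fq] : Type _ :=
  @RatFunc.CompletionAtInfty Fq _ (Classical.decEq _)

noncomputable instance KInfty.instValued (Fq : Type*) [Field Fq] : Valued (KInfty Fq) ℤᵐ⁰ :=
  letI : DecidableEq (RatFunc Fq) := Classical.decEq _
  inferInstance

/-- The valuation of `θ` (the variable of `𝔽_q(θ)`) in `K_∞`. -/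
theorem KInfty.v_theta (Fq : Type*) [Field Fq] :
    (KInfty.instValued Fq).v (algebraMap (RatFunc Fq) (KInfty Fq) RatFunc.X) =
      WithZero.exp (1 : ℤ) := by
  let : DecidableEq (RatFunc Fq) := Classical.decEq _
  let : Valued (RatFunc Fq) ℤᵐ⁰ := RatFunc.inftyValued Fq
  have h := Valued.extensionValuation_apply_coe (K := RatFunc Fq) (Γ₀ := ℤᵐ⁰) RatFunc.X
  exact h.trans (RatFunc.inftyValuation.X Fq)

section Fields

variable (Fq : Type*) [Field Fq] [Fintype Fq]

theorem KInfty.card_ne_zero : ((Fintype.card Fq : ℕ) : ℝ≥0) ≠ 0 := by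
  exact_mod_cast (Fintype.card_ne_zero : Fintype.card Fq ≠ 0)

/-- The valuation on `K_∞` has rank one: the valuation `exp m` corresponds to the
real number `q ^ m`, so that `|θ|_∞ = q`. -/
noncomputable instance KInfty.instRankOne : (KInfty.instValued Fq).v.RankOne where
  hom' := (WithZeroMulInt.toNNReal (KInfty.card_ne_zero Fq)).comp
    MonoidWithZeroHom.ValueGroup₀.embedding
  strictMono' := (WithZeroMulInt.toNNReal_strictMono
    (by exact_mod_cast (Fintype.one_lt_card : 1 < Fintype.card Fq))).comp
    MonoidWithZeroHom.ValueGroup₀.embedding_strictMono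
  exists_val_nontrivial := ⟨algebraMap (RatFunc Fq) (KInfty Fq) RatFunc.X, by
    rw [KInfty.v_theta]; simp⟩

noncomputable instance KInfty.instNontriviallyNormedField :
    NontriviallyNormedField (KInfty Fq) :=
  Valued.toNontriviallyNormedField (KInfty Fq) ℤᵐ⁰

instance KInfty.instIsUltrametricDist : IsUltrametricDist (KInfty Fq) :=
  Valued.instIsUltrametricDist (KInfty Fq) ℤᵐ⁰

instance KInfty.instCompleteSpace : CompleteSpace (KInfty Fq) :=
  let : DecidableEq (RatFunc Fq) := Classical.decEq _
  let : UniformSpace (RatFunc Fq) := (RatFunc.inftyValued Fq).toUniformSpace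
  UniformSpace.Completion.completeSpace (RatFunc Fq)

/-- The algebraic closure of `K_∞`. -/
abbrev KInftyBar : Type _ := AlgebraicClosure (KInfty Fq)

/-- The algebraic closure of `K_∞` carries the unique extension of `|·|_∞`. -/
noncomputable instance KInftyBar.instNontriviallyNormedField :
    NontriviallyNormedField (KInftyBar Fq) :=
  spectralNorm.nontriviallyNormedField (KInfty Fq) (KInftyBar Fq)

instance KInftyBar.instIsUltrametricDist : IsUltrametricDist (KInftyBar Fq) :=
  IsUltrametricDist.isUltrametricDist_of_forall_norm_add_le_max_norm
    (isNonarchimedean_spectralNorm (K := KInfty Fq) (L := KInftyBar Fq))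

/-- `ℂ_∞`, the completion of the algebraic closure of `K_∞`. -/
def CInfty : Type _ := UniformSpace.Completion (KInftyBar Fq)

noncomputable instance CInfty.instNormedField : NormedField (CInfty Fq) :=
  inferInstanceAs (NormedField (UniformSpace.Completion (KInftyBar Fq)))

instance CInfty.instCompleteSpace : CompleteSpace (CInfty Fq) :=
  inferInstanceAs (CompleteSpace (UniformSpace.Completion (KInftyBar Fq)))

/-- The embedding of `K_∞` in `ℂ_∞`. -/
noncomputable def CInfty.ofKInfty : KInfty Fq →+* CInfty Fq :=
  (UniformSpace.Completion.coeRingHom : KInftyBar Fq →+* _).comp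
    (algebraMap (KInfty Fq) (KInftyBar Fq))

theorem CInfty.norm_ofKInfty (x : KInfty Fq) : ‖CInfty.ofKInfty Fq x‖ = ‖x‖ :=
  (UniformSpace.Completion.norm_coe (algebraMap (KInfty Fq) (KInftyBar Fq) x)).trans
    (spectralNorm_extends (L := KInftyBar Fq) x)

/-- `ℂ_∞` as an algebra over the constants `𝔽_q ⊂ 𝔽_q(θ) ⊂ K_∞`. -/
noncomputable instance CInfty.instAlgebra : Algebra Fq (CInfty Fq) :=
  ((CInfty.ofKInfty Fq).comp
    ((algebraMap (RatFunc Fq) (KInfty Fq)).comp (algebraMap Fq (RatFunc Fq)))).toAlgebra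

/-- The element `θ` of `ℂ_∞`. -/
noncomputable def theta : CInfty Fq :=
  CInfty.ofKInfty Fq (algebraMap (RatFunc Fq) (KInfty Fq) RatFunc.X)

theorem norm_theta : ‖theta Fq‖ = Fintype.card Fq := by
  rw [theta, CInfty.norm_ofKInfty, Valued.toNormedField.norm_def]
  change ((WithZeroMulInt.toNNReal (KInfty.card_ne_zero Fq)
    (MonoidWithZeroHom.ValueGroup₀.embedding ((KInfty.instValued Fq).v.restrict _)) : ℝ≥0) : ℝ)
      = _
  rw [Valuation.restrict_def, MonoidWithZeroHom.ValueGroup₀.embedding_restrict₀]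
  change ((WithZeroMulInt.toNNReal (KInfty.card_ne_zero Fq)
    ((KInfty.instValued Fq).v (algebraMap (RatFunc Fq) (KInfty Fq) RatFunc.X)) : ℝ≥0) : ℝ) = _
  rw [KInfty.v_theta, WithZeroMulInt.toNNReal_neg_apply _ WithZero.exp_ne_zero]
  have h : WithZero.unzero (WithZero.exp_ne_zero : WithZero.exp (1 : ℤ) ≠ 0) =
      Multiplicative.ofAdd (1 : ℤ) := rfl
  rw [h]
  simp

/-- The ring `A = 𝔽_q[θ]`, as a subring of `ℂ_∞`. -/
noncomputable def ringA : Subalgebra Fq (CInfty Fq) := Algebra.adjoin Fq {theta Fq}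

end Fields

/-! ## Power series over `ℂ_∞` in the second variable `t` -/

section TateAlgebra

variable {Fq : Type*} [Field Fq] [Fintype Fq]

/-- `f` lies in the Tate algebra `𝕋`, i.e. converges on `|t|_∞ ≤ 1`. -/
def IsTate (f : (CInfty Fq)⟦X⟧) : Prop := PowerSeries.IsRestricted 1 f

/-- The Frobenius twist `f = ∑ aᵢ tⁱ ↦ f⁽¹⁾ = ∑ aᵢ^q tⁱ`. -/
noncomputable def twist : (CInfty Fq)⟦X⟧ →+* (CInfty Fq)⟦X⟧ :=
  PowerSeries.map (FiniteField.frobeniusAlgHom Fq (CInfty Fq)).toRingHom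

/-- The operator `℘(f) = f - f⁽¹⁾`. -/
noncomputable def wp (f : (CInfty Fq)⟦X⟧) : (CInfty Fq)⟦X⟧ := f - twist f

/-- The series `f` converges at `t = θ`, with value `v`. -/
def EvalsTo (f : (CInfty Fq)⟦X⟧) (v : CInfty Fq) : Prop :=
  HasSum (fun k : ℕ => coeff k f * theta Fq ^ k) v

open scoped PowerSeries.WithPiTopology in
/-- `Ω(t) = (-θ)^{-q/(q-1)} ∏_{i ≥ 1} (1 - t / θ^{q^i})`, where `lam` is the chosen
`(q-1)`-th root of `-θ`. The product is taken for coefficientwise convergence. -/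
noncomputable def Omega (lam : CInfty Fq) : (CInfty Fq)⟦X⟧ :=
  C ((lam ^ Fintype.card Fq)⁻¹) *
    ∏' i : ℕ, (1 - C ((theta Fq ^ Fintype.card Fq ^ (i + 1))⁻¹) * PowerSeries.X)

/-- `π̃ = 1 / Ω(θ)`. -/
noncomputable def piTilde (lam : CInfty Fq) : CInfty Fq :=
  (∑' k : ℕ, coeff k (Omega lam) * theta Fq ^ k)⁻¹

theorem EvalsTo.add {f g : (CInfty Fq)⟦X⟧} {v w : CInfty Fq} (hf : EvalsTo f v)
    (hg : EvalsTo g w) : EvalsTo (f + g) (v + w) := by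
  have h := HasSum.add hf hg
  simpa [EvalsTo, add_mul] using h

theorem EvalsTo.poly_smul {f : (CInfty Fq)⟦X⟧} {v : CInfty Fq} (hf : EvalsTo f v)
    (p : Polynomial Fq) : EvalsTo (p • f) (Polynomial.aeval (theta Fq) p * v) := by
  induction p using Polynomial.induction_on' with
  | add p r hp hr =>
    rw [add_smul, map_add, add_mul]
    exact hp.add hr
  | monomial n a =>
    have h : (Polynomial.monomial n a) • f =
        PowerSeries.X ^ n * (C (algebraMap Fq (CInfty Fq) a) * f) := by
      rw [Algebra.smul_def, PowerSeries.algebraMap_apply', Polynomial.coe_monomial,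
        PowerSeries.monomial_eq_C_mul_X_pow, map_mul, map_pow, PowerSeries.map_X,
        PowerSeries.map_C]
      ring
    have h' : HasSum (fun k : ℕ => algebraMap Fq (CInfty Fq) a * theta Fq ^ n *
        (coeff k f * theta Fq ^ k)) (algebraMap Fq (CInfty Fq) a * theta Fq ^ n * v) :=
      HasSum.mul_left _ hf
    rw [h, Polynomial.aeval_monomial, EvalsTo]
    refine (Function.Injective.hasSum_iff (add_left_injective n) ?_).mp (h'.congr_fun ?_)
    · intro k hk
      rw [PowerSeries.coeff_X_pow_mul', if_neg, zero_mul]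
      intro hnk
      exact hk ⟨k - n, Nat.sub_add_cancel hnk⟩
    · intro k
      simp only [Function.comp_apply, PowerSeries.coeff_X_pow_mul, PowerSeries.coeff_C_mul]
      ring

end TateAlgebra

/-! ## Multiple polylogarithms: algebraic step -/

section Polylogarithms

variable {Fq : Type*} [Field Fq] [Fintype Fq]

/-- `f = (𝔏i°_{0^1}(Z_d), …, 𝔏i°_{0^d}(Z_1,…,Z_d))` is a solution in `𝕋^d` of the system
`℘(𝔏i_{0^i}(Z_{d-i+1},…,Z_d)) = Z_{d-i+1} · 𝔏i_{0^{i-1}}(Z_{d-i+2},…,Z_d)⁽¹⁾`, `1 ≤ i ≤ d`,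
where `𝔏i_{0^0} = 1`. -/
def IsSolution {d : ℕ} (Z f : Fin d → (CInfty Fq)⟦X⟧) : Prop :=
  (∀ i, IsTate (f i)) ∧
    ∀ i : Fin d, wp (f i) = Z i.rev * twist (Matrix.vecCons 1 f i.castSucc)

/-- The vector `(0^{d-k}, 1, f_1, …, f_k)` of length `d + 1`. -/
noncomputable def padVec {d k : ℕ} (hk : k ≤ d) (f : Fin k → (CInfty Fq)⟦X⟧) :
    Fin (d + 1) → (CInfty Fq)⟦X⟧ := fun j =>
  if h : d - k < (j : ℕ) then f ⟨j - (d - k) - 1, by omega⟩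
  else if (j : ℕ) = d - k then 1 else 0

/-- The module `𝕄_{0^{d+1}}^{Z_1,…,Z_d}` generated over `𝔽_q[t]` by the vectors
`𝔏i°_{0^{d+1}}(Z_1,…,Z_k) = (0^{d-k}, 1, 𝔏i°_{0^1}(Z_k), …, 𝔏i°_{0^k}(Z_1,…,Z_k))`,
`0 ≤ k ≤ d`, for all choices of the solutions. -/
noncomputable def monodromyZero {d : ℕ} (Z : Fin d → (CInfty Fq)⟦X⟧) :
    Submodule (Polynomial Fq) (Fin (d + 1) → (CInfty Fq)⟦X⟧) :=
  Submodule.span _ {F | ∃ (k : ℕ) (hk : k ≤ d) (f : Fin k → (CInfty Fq)⟦X⟧),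
    IsSolution (fun i => Z (Fin.castLE hk i)) f ∧ F = padVec hk f}

/-- `g = (𝔏i^{⋆,°}_{0^d}(Z_1,…,Z_d), …, 𝔏i^{⋆,°}_{0^1}(Z_d))` is a solution in `𝕋^d` of the system
`℘(𝔏i^⋆_{0^i}(Z_{d-i+1},…,Z_d)) = Z_{d-i+1} · 𝔏i^⋆_{0^{i-1}}(Z_{d-i+2},…,Z_d)`, `1 ≤ i ≤ d`,
where `𝔏i^⋆_{0^0} = 1`. The order of the coordinates is opposite to that of `IsSolution`. -/
def IsStarSolution {d : ℕ} (Z g : Fin d → (CInfty Fq)⟦X⟧) : Prop :=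
  (∀ i, IsTate (g i)) ∧
    ∀ i : Fin d, wp (g i) = Z i * Fin.snoc (α := fun _ => (CInfty Fq)⟦X⟧) g 1 i.succ

/-- The vector `(g_1, …, g_k, 1, 0^{d-k})` of length `d + 1`. -/
noncomputable def starPadVec {d k : ℕ} (g : Fin k → (CInfty Fq)⟦X⟧) :
    Fin (d + 1) → (CInfty Fq)⟦X⟧ := fun j =>
  if h : (j : ℕ) < k then g ⟨j, h⟩ else if (j : ℕ) = k then 1 else 0

/-- The module `𝕄_{0^{d+1}}^{⋆,Z_1,…,Z_d}` generated over `𝔽_q[t]` by the vectors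
`𝔏i^{⋆,°}_{0^{d+1}}(Z_1,…,Z_k) = (𝔏i^{⋆,°}_{0^k}(Z_1,…,Z_k), …, 𝔏i^{⋆,°}_{0^1}(Z_k), 1, 0^{d-k})`,
`0 ≤ k ≤ d`, for all choices of the solutions. -/
noncomputable def starMonodromyZero {d : ℕ} (Z : Fin d → (CInfty Fq)⟦X⟧) :
    Submodule (Polynomial Fq) (Fin (d + 1) → (CInfty Fq)⟦X⟧) :=
  Submodule.span _ {F | ∃ (k : ℕ) (hk : k ≤ d) (g : Fin k → (CInfty Fq)⟦X⟧),
    IsStarSolution (fun i => Z (Fin.castLE hk i)) g ∧ F = starPadVec g}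

/-! ## Analytic step -/

/-- `𝕄_{n_1,…,n_{d+1}}^{Z_1,…,Z_d}
= Ω^{-n_1-⋯-n_{d+1}} 𝕄_{0^{d+1}}^{Ω^{n_1} Z_1, …, Ω^{n_d} Z_d}`. -/
noncomputable def motivicMonodromy (lam : CInfty Fq) {d : ℕ} (n : Fin (d + 1) → ℕ)
    (Z : Fin d → (CInfty Fq)⟦X⟧) :
    Submodule (Polynomial Fq) (Fin (d + 1) → (CInfty Fq)⟦X⟧) :=
  (monodromyZero fun i => Omega lam ^ n i.castSucc * Z i).map
    ((Omega lam)⁻¹ ^ (∑ i, n i) • LinearMap.id)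

/-- `𝕄_{n_1,…,n_{d+1}}^{⋆,Z_1,…,Z_d}
= Ω^{-n_1-⋯-n_{d+1}} 𝕄_{0^{d+1}}^{⋆,Ω^{n_1} Z_1, …, Ω^{n_d} Z_d}`. -/
noncomputable def motivicStarMonodromy (lam : CInfty Fq) {d : ℕ} (n : Fin (d + 1) → ℕ)
    (Z : Fin d → (CInfty Fq)⟦X⟧) :
    Submodule (Polynomial Fq) (Fin (d + 1) → (CInfty Fq)⟦X⟧) :=
  (starMonodromyZero fun i => Omega lam ^ n i.castSucc * Z i).map
    ((Omega lam)⁻¹ ^ (∑ i, n i) • LinearMap.id)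

/-- `F ∈ 𝕋^d` represents the class
`𝔏i_{n_1,…,n_d}(Z_1,…,Z_d) = Ω^{-n_1-⋯-n_d} 𝔏i_{0^d}(Ω^{n_1} Z_1, …, Ω^{n_d} Z_d)`. -/
def RepresentsLi (lam : CInfty Fq) {d : ℕ} (n : Fin d → ℕ)
    (Z F : Fin d → (CInfty Fq)⟦X⟧) : Prop :=
  ∃ f, IsSolution (fun i => Omega lam ^ n i * Z i) f ∧ F = (Omega lam)⁻¹ ^ (∑ i, n i) • f

/-- `F ∈ 𝕋^d` represents the class
`𝔏i^⋆_{n_1,…,n_d}(Z_1,…,Z_d) = Ω^{-n_1-⋯-n_d} 𝔏i^⋆_{0^d}(Ω^{n_1} Z_1, …, Ω^{n_d} Z_d)`. -/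
def RepresentsStarLi (lam : CInfty Fq) {d : ℕ} (n : Fin d → ℕ)
    (Z F : Fin d → (CInfty Fq)⟦X⟧) : Prop :=
  ∃ g, IsStarSolution (fun i => Omega lam ^ n i * Z i) g ∧ F = (Omega lam)⁻¹ ^ (∑ i, n i) • g

/-! ## Evaluation step -/

/-- The submodule of `ℂ_∞^d` over `A = 𝔽_q[θ]` obtained from a submodule of `ℂ_∞⟦t⟧^d` over
`𝔽_q[t]` by evaluation at `t = θ`. -/
noncomputable def evalModule {d : ℕ} (M : Submodule (Polynomial Fq) (Fin d → (CInfty Fq)⟦X⟧)) :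
    Submodule (ringA Fq) (Fin d → CInfty Fq) where
  carrier := {v | ∃ F ∈ M, ∀ i, EvalsTo (F i) (v i)}
  zero_mem' := ⟨0, M.zero_mem, fun i => by simp [EvalsTo, hasSum_zero]⟩
  add_mem' := by
    rintro v w ⟨F, hF, hFv⟩ ⟨G, hG, hGw⟩
    exact ⟨F + G, M.add_mem hF hG, fun i => (hFv i).add (hGw i)⟩
  smul_mem' := by
    rintro ⟨a, ha⟩ v ⟨F, hF, hFv⟩
    rw [ringA, Algebra.adjoin_singleton_eq_range_aeval] at ha
    obtain ⟨p, rfl⟩ := ha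
    exact ⟨p • F, M.smul_mem p hF, fun i => (hFv i).poly_smul p⟩

/-- The monodromy module `M_{n_1,…,n_{d+1}}^{z_1,…,z_d}`. -/
noncomputable def monodromyModule (lam : CInfty Fq) {d : ℕ} (n : Fin (d + 1) → ℕ)
    (z : Fin d → CInfty Fq) : Submodule (ringA Fq) (Fin (d + 1) → CInfty Fq) :=
  evalModule (motivicMonodromy lam n fun i => C (z i))

/-- The monodromy module `M_{n_1,…,n_{d+1}}^{⋆,z_1,…,z_d}`. -/
noncomputable def starMonodromyModule (lam : CInfty Fq) {d : ℕ} (n : Fin (d + 1) → ℕ)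
    (z : Fin d → CInfty Fq) : Submodule (ringA Fq) (Fin (d + 1) → CInfty Fq) :=
  evalModule (motivicStarMonodromy lam n fun i => C (z i))

/-- `c` is the class `Li_{n_1,…,n_{d+1}}(z_1,…,z_d,w)` in
`ℂ_∞^{d+1} / M_{n_1,…,n_{d+1}}^{z_1,…,z_d}`: the class of the value at `t = θ` of a representative
of `𝔏i_{n_1,…,n_{d+1}}(z_1,…,z_d,w)`. -/
def IsLiValue (lam : CInfty Fq) {d : ℕ} (n : Fin (d + 1) → ℕ) (z : Fin d → CInfty Fq)
    (w : CInfty Fq) (c : (Fin (d + 1) → CInfty Fq) ⧸ monodromyModule lam n z) : Prop :=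
  ∃ F v, RepresentsLi lam n (fun i => C (Fin.snoc (α := fun _ => CInfty Fq) z w i)) F ∧
    (∀ i, EvalsTo (F i) (v i)) ∧ c = Submodule.Quotient.mk v

/-- `c` is the class `Li^⋆_{n_1,…,n_{d+1}}(z_1,…,z_d,w)` in
`ℂ_∞^{d+1} / M_{n_1,…,n_{d+1}}^{⋆,z_1,…,z_d}`. -/
def IsStarLiValue (lam : CInfty Fq) {d : ℕ} (n : Fin (d + 1) → ℕ) (z : Fin d → CInfty Fq)
    (w : CInfty Fq) (c : (Fin (d + 1) → CInfty Fq) ⧸ starMonodromyModule lam n z) : Prop :=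
  ∃ F v, RepresentsStarLi lam n (fun i => C (Fin.snoc (α := fun _ => CInfty Fq) z w i)) F ∧
    (∀ i, EvalsTo (F i) (v i)) ∧ c = Submodule.Quotient.mk v

/-- `L` is a branch `Li°_{n_1,…,n_{d+1}}(z_1,…,z_d,-) : ℂ_∞ → ℂ_∞^{d+1}`, i.e. an `𝔽_q`-linear
lift of `Li_{n_1,…,n_{d+1}}(z_1,…,z_d,-) : ℂ_∞ → ℂ_∞^{d+1} / M_{n_1,…,n_{d+1}}^{z_1,…,z_d}`. -/
def IsBranch (lam : CInfty Fq) {d : ℕ} (n : Fin (d + 1) → ℕ) (z : Fin d → CInfty Fq)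
    (L : CInfty Fq →ₗ[Fq] (Fin (d + 1) → CInfty Fq)) : Prop :=
  ∀ w, IsLiValue lam n z w (Submodule.Quotient.mk (L w))

/-- `L` is a branch `Li^{⋆,°}_{n_1,…,n_{d+1}}(z_1,…,z_d,-) : ℂ_∞ → ℂ_∞^{d+1}`, i.e. an
`𝔽_q`-linear lift of `Li^⋆_{n_1,…,n_{d+1}}(z_1,…,z_d,-)`. -/
def IsStarBranch (lam : CInfty Fq) {d : ℕ} (n : Fin (d + 1) → ℕ) (z : Fin d → CInfty Fq)
    (L : CInfty Fq →ₗ[Fq] (Fin (d + 1) → CInfty Fq)) : Prop :=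
  ∀ w, IsStarLiValue lam n z w (Submodule.Quotient.mk (L w))

/-- For a branch vector `v = Li^{⋆,°}_{n_d,…,n_1}(z_d,…,z_1)` of depth `d`, the vector
`Li^{⋆,°}_{n_d,…,n_1}(-z_d,…,-z_1)`, obtained by putting
`Li^{⋆,°}_{n_i,…,n_1}(-z_i,…,-z_1) = (-1)^i Li^{⋆,°}_{n_i,…,n_1}(z_i,…,z_1)`:
the coordinate number `j` (counted from `0`) involves depth `i = d - j`. -/
noncomputable def negArgs {d : ℕ} (v : Fin d → CInfty Fq) : Fin d → CInfty Fq :=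
  fun j => (-1) ^ (d - (j : ℕ)) * v j

end Polylogarithms

/-! The identity comes from a duality over the Tate algebra, specialised at `t = θ`. Put `Z_i =
Ω^{n_i} z_i`. Prepending the initial term to a solution gives `p` with `℘(p_{i+1}) = Z_{i.rev}
p_i⁽¹⁾`. Appending it to a star solution for the reversed data gives `s` with `℘(s_i) = Z_{i.rev}
s_{i+1}`. Since `℘(s p) = s ℘(p) + ℘(s) p⁽¹⁾`, applying `℘` to the alternating sum of the `s_j p_j`
produces each `Z_{i.rev} s_{i+1} p_i⁽¹⁾` twice, with opposite signs. The sum is therefore fixed by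
the twist, hence a polynomial `a` over `𝔽_q` (`exists_sum_mul_eq_algebraMap`).

A branch is determined only up to monodromy. A monodromy vector, extended by a zero initial term,
solves the same homogeneous linear system, so adding it changes nothing in the argument
(`IsBranch.exists_evalsTo`, `IsStarBranch.exists_evalsTo`).

Each of the two vectors carries a factor `Ω^{-N}`. Evaluation is multiplicative and `Ω⁻¹` takes the
value `π̃` at `θ` (`evalsTo_inv_Omega`), so the pairing of values is `π̃^{2N} a(θ)`. -/

/-- In a nonarchimedean ring the double family of products is automatically summable, so the Cauchy
product needs no absolute convergence. -/
theorem HasSum.mul_antidiagonal_of_nonarchimedean {K : Type*} [NormedField K]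
    [NonarchimedeanRing K]
    {f g : ℕ → K} {v w : K} (hf : HasSum f v)
    (hg : HasSum g w) :
    HasSum (fun k : ℕ => ∑ y ∈ Finset.HasAntidiagonal.antidiagonal k, f y.1 * g y.2) (v * w) := by
  have h := HasSum.mul_of_nonarchimedean hf hg
  have he := hf.summable.tsum_mul_tsum_eq_tsum_sum_antidiagonal hg.summable h.summable
  rw [hf.tsum_eq, hg.tsum_eq] at he
  rw [he]
  exact (summable_sum_mul_antidiagonal_of_summable_mul h.summable).hasSum

theorem PowerSeries.coeff_mul_mul_pow {K : Type*} [NormedField K] (x : K) (f g : K⟦X⟧) (k : ℕ) :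
    coeff k (f * g) * x ^ k = ∑ y ∈ Finset.HasAntidiagonal.antidiagonal k,
      coeff y.1 f * x ^ y.1 * (coeff y.2 g * x ^ y.2) := by
  rw [PowerSeries.coeff_mul, Finset.sum_mul]
  refine Finset.sum_congr rfl fun y hy => ?_
  rw [← Finset.HasAntidiagonal.mem_antidiagonal.mp hy, pow_add, mul_mul_mul_comm]

/-- Evaluation of power series over a non-archimedean field is multiplicative. -/
theorem PowerSeries.hasSum_coeff_mul {K : Type*} [NormedField K] [IsUltrametricDist K] (x : K)
    {f g : K⟦X⟧} {v w : K} (hf : HasSum (fun k : ℕ => coeff k f * x ^ k) v)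
    (hg : HasSum (fun k : ℕ => coeff k g * x ^ k) w) :
    HasSum (fun k : ℕ => coeff k (f * g) * x ^ k) (v * w) := by
  have : NonarchimedeanRing K :=
    { is_nonarchimedean := (inferInstance : NonarchimedeanAddGroup K).is_nonarchimedean }
  exact (hf.mul_antidiagonal_of_nonarchimedean hg).congr_fun fun k => PowerSeries.coeff_mul_mul_pow x f g k

/-! ### The ultrametric on `ℂ_∞` and the fixed points of Frobenius -/

section CInftyBasics

variable (Fq : Type*) [Field Fq] [Fintype Fq]

instance CInfty.instIsUltrametricDist : IsUltrametricDist (CInfty Fq) :=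
  IsUltrametricDist.isUltrametricDist_of_forall_norm_add_le_max_norm fun x y => by
    refine UniformSpace.Completion.induction_on₂
      (p := fun x y : UniformSpace.Completion (KInftyBar Fq) => ‖x + y‖ ≤ max ‖x‖ ‖y‖) x y
      (isClosed_le (by fun_prop) (by fun_prop)) fun a b => ?_
    rw [← UniformSpace.Completion.coe_add]
    simp only [UniformSpace.Completion.norm_coe]
    exact IsUltrametricDist.norm_add_le_max a b

variable {Fq}

/-- `X^q - X` is the product of the `X - a` over `a ∈ 𝔽_q`; at a root `x` one of these factors must
vanish. -/
theorem CInfty.exists_algebraMap_eq_of_pow_card_eq {x : CInfty Fq}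
    (hx : x ^ Fintype.card Fq = x) : ∃ a : Fq, algebraMap Fq (CInfty Fq) a = x := by
  have h : (Polynomial.X ^ Fintype.card Fq - Polynomial.X : Polynomial Fq) =
      ∏ a : Fq, (Polynomial.X - Polynomial.C a) := by
    have := FiniteField.roots_X_pow_card_sub_X Fq
    have hm : (Polynomial.X ^ Fintype.card Fq - Polynomial.X : Polynomial Fq).Monic :=
      Polynomial.monic_X_pow_sub (by
        rw [Polynomial.degree_X]; exact_mod_cast Fintype.one_lt_card)
    rw [← Polynomial.prod_multiset_X_sub_C_of_monic_of_roots_card_eq hm, this]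
    · rfl
    · rw [this, FiniteField.X_pow_card_sub_X_natDegree_eq Fq Fintype.one_lt_card]
      rfl
  have h0 := congrArg (Polynomial.aeval x) h
  simp only [map_sub, map_pow, Polynomial.aeval_X, hx, sub_self, map_prod, Polynomial.aeval_C] at h0
  obtain ⟨a, -, ha⟩ := Finset.prod_eq_zero_iff.mp h0.symm
  exact ⟨a, (sub_eq_zero.mp ha).symm⟩

theorem CInfty.norm_eq_one_of_pow_card_eq {x : CInfty Fq} (hx : x ^ Fintype.card Fq = x)
    (h0 : x ≠ 0) : ‖x‖ = 1 := by
  have h1 : 1 < Fintype.card Fq := Fintype.one_lt_card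
  have h : x ^ (Fintype.card Fq - 1) = 1 := by
    apply mul_right_cancel₀ h0
    rw [← pow_succ, Nat.sub_add_cancel h1.le, hx, one_mul]
  have h' := congrArg norm h
  rw [norm_pow, norm_one] at h'
  exact (pow_eq_one_iff_of_nonneg (norm_nonneg x) (by omega)).mp h'

theorem theta_ne_zero : theta Fq ≠ 0 := by
  rw [← norm_ne_zero_iff, norm_theta]
  exact_mod_cast Fintype.card_ne_zero

end CInftyBasics

/-! ### The twist and its invariants in the Tate algebra -/

section Twist

variable {Fq : Type*} [Field Fq] [Fintype Fq]

theorem coeff_twist (f : (CInfty Fq)⟦X⟧) (k : ℕ) :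
    coeff k (twist f) = coeff k f ^ Fintype.card Fq := by
  rw [twist, PowerSeries.coeff_map]
  rfl

/-- The twist fixes `t` and, because `a^q = a` on `𝔽_q`, also the constants. -/
theorem twist_poly_smul (p : Polynomial Fq) (f : (CInfty Fq)⟦X⟧) :
    twist (p • f) = p • twist f := by
  rw [Algebra.smul_def, Algebra.smul_def, map_mul]
  congr 1
  ext k
  rw [coeff_twist, PowerSeries.algebraMap_apply', PowerSeries.coeff_map, ← map_pow,
    Polynomial.coeff_coe, FiniteField.pow_card]

theorem wp_poly_smul (p : Polynomial Fq) (f : (CInfty Fq)⟦X⟧) : wp (p • f) = p • wp f := by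
  rw [wp, wp, twist_poly_smul, smul_sub]

theorem isTate_iff {f : (CInfty Fq)⟦X⟧} :
    IsTate f ↔ Tendsto (fun k => coeff k f) atTop (𝓝 0) := by
  rw [IsTate, PowerSeries.isRestricted_iff',
    tendsto_zero_iff_norm_tendsto_zero (f := fun k => coeff k f)]
  simp

theorem isTate_algebraMap (p : Polynomial Fq) :
    IsTate (algebraMap (Polynomial Fq) (CInfty Fq)⟦X⟧ p) := by
  rw [isTate_iff]
  refine tendsto_const_nhds.congr' ?_
  filter_upwards [eventually_gt_atTop p.natDegree] with k hk
  rw [PowerSeries.algebraMap_apply', PowerSeries.coeff_map, Polynomial.coeff_coe,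
    Polynomial.coeff_eq_zero_of_natDegree_lt hk, map_zero]

/-- The Tate algebra as a subalgebra over `𝔽_q[t]`. -/
noncomputable def tateSubalgebra : Subalgebra (Polynomial Fq) (CInfty Fq)⟦X⟧ where
  __ := PowerSeries.IsRestricted.subring (R := CInfty Fq) 1
  algebraMap_mem' := isTate_algebraMap

theorem mem_tateSubalgebra {f : (CInfty Fq)⟦X⟧} : f ∈ tateSubalgebra ↔ IsTate f := Iff.rfl

/-- The elements of the Tate algebra fixed by the twist are the polynomials over `𝔽_q`. -/
theorem IsTate.exists_eq_algebraMap_of_wp_eq_zero {f : (CInfty Fq)⟦X⟧} (hf : IsTate f)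
    (h : wp f = 0) : ∃ p : Polynomial Fq, f = algebraMap (Polynomial Fq) (CInfty Fq)⟦X⟧ p := by
  have hk (k : ℕ) : coeff k f ^ Fintype.card Fq = coeff k f := by
    rw [← coeff_twist, ← sub_eq_zero.mp h]
  choose a ha using fun k => CInfty.exists_algebraMap_eq_of_pow_card_eq (hk k)
  -- The coefficients lie in `𝔽_q`, so their norms are `0` or `1`; tending to zero, they vanish from
  -- some index on.
  obtain ⟨m, hm⟩ := eventually_atTop.mp
    ((isTate_iff.mp hf).norm.eventually_lt_const (by simp : ‖(0 : CInfty Fq)‖ < 1))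
  refine ⟨PowerSeries.trunc m (PowerSeries.mk a), ?_⟩
  ext k
  rw [PowerSeries.algebraMap_apply', PowerSeries.coeff_map, Polynomial.coeff_coe,
    PowerSeries.coeff_trunc]
  split_ifs with hkm
  · rw [PowerSeries.coeff_mk, ha]
  · rw [map_zero]
    by_contra h0
    exact (hm k (not_lt.mp hkm)).ne (CInfty.norm_eq_one_of_pow_card_eq (hk k) h0)

end Twist

/-! ### Evaluation at `t = θ` -/

section Evaluation

variable {Fq : Type*} [Field Fq] [Fintype Fq]

theorem EvalsTo.unique {f : (CInfty Fq)⟦X⟧} {v w : CInfty Fq} (hv : EvalsTo f v)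
    (hw : EvalsTo f w) : v = w :=
  HasSum.unique hv hw

theorem evalsTo_C (a : CInfty Fq) : EvalsTo (C a) a := by
  have h := hasSum_single (f := fun k : ℕ => coeff k (C a) * theta Fq ^ k) 0 (by
    intro k hk
    rw [PowerSeries.coeff_C, if_neg hk, zero_mul])
  simpa [EvalsTo] using h

theorem EvalsTo.mul {f g : (CInfty Fq)⟦X⟧} {v w : CInfty Fq} (hf : EvalsTo f v)
    (hg : EvalsTo g w) : EvalsTo (f * g) (v * w) :=
  PowerSeries.hasSum_coeff_mul (theta Fq) hf hg

theorem EvalsTo.pow {f : (CInfty Fq)⟦X⟧} {v : CInfty Fq} (hf : EvalsTo f v) (m : ℕ) :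
    EvalsTo (f ^ m) (v ^ m) := by
  induction m with
  | zero => simpa using evalsTo_C (1 : CInfty Fq)
  | succ m ih => simpa only [pow_succ] using ih.mul hf

theorem EvalsTo.sum {ι : Type*} (s : Finset ι) {f : ι → (CInfty Fq)⟦X⟧} {v : ι → CInfty Fq}
    (h : ∀ i ∈ s, EvalsTo (f i) (v i)) : EvalsTo (∑ i ∈ s, f i) (∑ i ∈ s, v i) := by
  have := hasSum_sum h
  simpa [EvalsTo, Finset.sum_mul] using this

end Evaluation

/-! ### Convergence of `Ω⁻¹` at `θ` -/

section Omega

variable {Fq : Type*} [Field Fq] [Fintype Fq]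

/-- The power series with constant term `1` and `k`-th coefficient bounded by `r ^ k`. -/
noncomputable def geomBounded (r : ℝ≥0) : Submonoid (CInfty Fq)⟦X⟧ where
  carrier := {f | coeff 0 f = 1 ∧ ∀ k, ‖coeff k f‖ ≤ (r : ℝ) ^ k}
  one_mem' := ⟨by simp, fun k => by
    rw [PowerSeries.coeff_one]
    split_ifs with h
    · simp [h]
    · rw [norm_zero]; positivity⟩
  mul_mem' := by
    rintro f g ⟨hf0, hf⟩ ⟨hg0, hg⟩
    refine ⟨by simp_all, fun k => ?_⟩
    rw [PowerSeries.coeff_mul]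
    refine IsUltrametricDist.norm_sum_le_of_forall_le_of_nonneg (by positivity) fun x hx => ?_
    rw [norm_mul, ← Finset.HasAntidiagonal.mem_antidiagonal.mp hx, pow_add]
    exact mul_le_mul (hf _) (hg _) (norm_nonneg _) (by positivity)

open scoped PowerSeries.WithPiTopology in
theorem isClosed_geomBounded (r : ℝ≥0) :
    IsClosed ((geomBounded r : Submonoid (CInfty Fq)⟦X⟧) : Set (CInfty Fq)⟦X⟧) := by
  have hc (k : ℕ) := PowerSeries.WithPiTopology.continuous_coeff (CInfty Fq) k
  refine IsClosed.and (isClosed_eq (hc 0) continuous_const) ?_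
  rw [Set.ofPred_forall]
  exact isClosed_iInter fun k => isClosed_le (hc k).norm continuous_const

/-- With constant term `1`, each coefficient of the inverse is, up to sign, a sum of products of
coefficients of `f` with earlier ones of the inverse; the ultrametric inequality propagates the
bound. -/
theorem inv_mem_geomBounded {r : ℝ≥0} {f : (CInfty Fq)⟦X⟧} (hf : f ∈ geomBounded r) :
    f⁻¹ ∈ geomBounded r := by
  have hc : constantCoeff f = 1 := by simpa using hf.1
  refine ⟨by simp [hc], fun k => ?_⟩
  induction k using Nat.strong_induction_on with
  | _ k ih =>
    rw [PowerSeries.coeff_inv, hc]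
    split_ifs with h
    · simp [h]
    · rw [inv_one, neg_one_mul, norm_neg]
      refine IsUltrametricDist.norm_sum_le_of_forall_le_of_nonneg (by positivity) fun x hx => ?_
      split_ifs with h'
      · rw [norm_mul, ← Finset.HasAntidiagonal.mem_antidiagonal.mp hx, pow_add]
        exact mul_le_mul (hf.2 _) (ih _ h') (norm_nonneg _) (by positivity)
      · rw [norm_zero]; positivity

theorem one_sub_C_mul_X_mem_geomBounded {r : ℝ≥0} {a : CInfty Fq} (ha : ‖a‖ ≤ r) :
    1 - C a * PowerSeries.X ∈ geomBounded r := by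
  refine ⟨by simp, fun k => ?_⟩
  rcases k with _ | _ | k
  · simp
  · simpa [PowerSeries.coeff_one] using ha
  · simp [PowerSeries.coeff_one]

/-- As `|θ| = q`, the terms are bounded by `(r q)^k`, and in a complete ultrametric field it
suffices that terms tend to zero. -/
theorem exists_evalsTo_of_mem_geomBounded {r : ℝ≥0} (hr : r * Fintype.card Fq < 1)
    {f : (CInfty Fq)⟦X⟧} (hf : f ∈ geomBounded r) : ∃ v, EvalsTo f v := by
  refine (NonarchimedeanAddGroup.summable_of_tendsto_cofinite_zero ?_ :
    Summable fun k : ℕ => coeff k f * theta Fq ^ k)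
  rw [Nat.cofinite_eq_atTop]
  refine squeeze_zero_norm (a := fun k => ((r * Fintype.card Fq : ℝ≥0) : ℝ) ^ k) (fun k => ?_)
    (tendsto_pow_atTop_nhds_zero_of_lt_one (by positivity) (by exact_mod_cast hr))
  rw [norm_mul, norm_pow, norm_theta]
  push_cast
  rw [mul_pow]
  gcongr
  exact hf.2 k

open scoped PowerSeries.WithPiTopology in
/-- `Ω⁻¹` converges at `t = θ`, with value `π̃`. -/
theorem evalsTo_inv_Omega {lam : CInfty Fq} (hlam : lam ≠ 0) :
    EvalsTo (Omega lam)⁻¹ (piTilde lam) := by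
  have hq : 1 < Fintype.card Fq := Fintype.one_lt_card
  let q : ℝ≥0 := Fintype.card Fq
  have hq' : 1 < q := by simpa [q] using hq
  obtain ⟨P, hP, hO⟩ : ∃ P : (CInfty Fq)⟦X⟧,
      P ∈ geomBounded (q ^ 2)⁻¹ ∧ Omega lam = C ((lam ^ Fintype.card Fq)⁻¹) * P := by
    -- The radius `q⁻²` works because `q^(i+1) ≥ 2`. Multipliability need not be checked: the
    -- default value `1` of the product also lies in the submonoid.
    refine ⟨_, tprod_mem (isClosed_geomBounded _) fun i => one_sub_C_mul_X_mem_geomBounded ?_, rfl⟩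
    rw [norm_inv, norm_pow, norm_theta]
    push_cast
    refine inv_anti₀ (by positivity) (pow_le_pow_right₀ hq'.le ?_)
    calc 2 ≤ Fintype.card Fq ^ 1 := by rw [pow_one]; exact hq
      _ ≤ Fintype.card Fq ^ (i + 1) := Nat.pow_le_pow_right hq.le (by omega)
  have hr : (q ^ 2)⁻¹ * Fintype.card Fq < 1 := by
    change (q ^ 2)⁻¹ * q < 1
    rw [inv_mul_lt_iff₀ (by positivity), mul_one]
    exact lt_self_pow₀ hq' one_lt_two
  have hlq : lam ^ Fintype.card Fq ≠ 0 := pow_ne_zero _ hlam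
  have hPc : constantCoeff P ≠ 0 := by
    have : constantCoeff P = 1 := by simpa using hP.1
    simp [this]
  obtain ⟨v, hv⟩ := exists_evalsTo_of_mem_geomBounded hr hP
  obtain ⟨w, hw⟩ := exists_evalsTo_of_mem_geomBounded hr (inv_mem_geomBounded hP)
  have hOv : EvalsTo (Omega lam) ((lam ^ Fintype.card Fq)⁻¹ * v) := hO ▸ (evalsTo_C _).mul hv
  have hOw : EvalsTo (Omega lam)⁻¹ (w * lam ^ Fintype.card Fq) := by
    rw [hO, PowerSeries.mul_inv_rev, PowerSeries.C_inv, inv_inv]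
    exact hw.mul (evalsTo_C _)
  have hc : constantCoeff (Omega lam) ≠ 0 := by
    rw [hO, map_mul, PowerSeries.constantCoeff_C]
    exact mul_ne_zero (inv_ne_zero hlq) hPc
  have h1 : EvalsTo (1 : (CInfty Fq)⟦X⟧) 1 := by simpa using evalsTo_C (1 : CInfty Fq)
  -- The values of `Ω` and `Ω⁻¹` multiply to `1`, which identifies the latter with `π̃`.
  have h := (PowerSeries.mul_inv_cancel _ hc ▸ hOv.mul hOw).unique h1
  rw [piTilde, HasSum.tsum_eq hOv, inv_eq_of_mul_eq_one_right h]
  exact hOw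

end Omega

/-! ### Homogeneous systems and their duality -/

section Systems

variable {Fq : Type*} [Field Fq] [Fintype Fq]

theorem wp_mul (f g : (CInfty Fq)⟦X⟧) : wp (f * g) = f * wp g + wp f * twist g := by
  simp only [wp, map_mul]
  ring

theorem wp_add (f g : (CInfty Fq)⟦X⟧) : wp (f + g) = wp f + wp g := by
  simp only [wp, map_add]
  ring

@[simp]
theorem wp_zero : wp (0 : (CInfty Fq)⟦X⟧) = 0 := by simp [wp]

@[simp]
theorem wp_one : wp (1 : (CInfty Fq)⟦X⟧) = 0 := by simp [wp]

/-- The homogeneous version of the system `IsSolution`, where the initial term `f_0` is any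
element of `𝔽_q[t]`. -/
noncomputable def solutionModule {m : ℕ} (Z : Fin m → (CInfty Fq)⟦X⟧) :
    Submodule (Polynomial Fq) (Fin (m + 1) → (CInfty Fq)⟦X⟧) where
  carrier := {p | (∀ i, p i ∈ tateSubalgebra) ∧ wp (p 0) = 0 ∧
    ∀ i : Fin m, wp (p i.succ) = Z i.rev * twist (p i.castSucc)}
  zero_mem' := ⟨fun _ => zero_mem _, by simp, fun i => by simp⟩
  add_mem' := by
    rintro p r ⟨hpt, hp0, hp⟩ ⟨hrt, hr0, hr⟩
    refine ⟨fun i => add_mem (hpt i) (hrt i), by simp [wp_add, hp0, hr0], fun i => ?_⟩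
    simp only [Pi.add_apply, wp_add, hp, hr, map_add]
    ring
  smul_mem' := by
    rintro c p ⟨hpt, hp0, hp⟩
    refine ⟨fun i => Subalgebra.smul_mem _ (hpt i) c, by simp [wp_poly_smul, hp0], fun i => ?_⟩
    simp only [Pi.smul_apply, wp_poly_smul, hp, twist_poly_smul, mul_smul_comm]

/-- The homogeneous version of the system `IsStarSolution`, where the initial term `g_0` is any
element of `𝔽_q[t]`. -/
noncomputable def starSolutionModule {m : ℕ} (Z : Fin m → (CInfty Fq)⟦X⟧) :
    Submodule (Polynomial Fq) (Fin (m + 1) → (CInfty Fq)⟦X⟧) where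
  carrier := {p | (∀ i, p i ∈ tateSubalgebra) ∧ wp (p (Fin.last m)) = 0 ∧
    ∀ i : Fin m, wp (p i.castSucc) = Z i * p i.succ}
  zero_mem' := ⟨fun _ => zero_mem _, by simp, fun i => by simp⟩
  add_mem' := by
    rintro p r ⟨hpt, hp0, hp⟩ ⟨hrt, hr0, hr⟩
    refine ⟨fun i => add_mem (hpt i) (hrt i), by simp [wp_add, hp0, hr0], fun i => ?_⟩
    simp only [Pi.add_apply, wp_add, hp, hr]
    ring
  smul_mem' := by
    rintro c p ⟨hpt, hp0, hp⟩
    refine ⟨fun i => Subalgebra.smul_mem _ (hpt i) c, by simp [wp_poly_smul, hp0], fun i => ?_⟩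
    simp only [Pi.smul_apply, wp_poly_smul, hp, mul_smul_comm]

theorem IsSolution.cons_mem {m : ℕ} {Z f : Fin m → (CInfty Fq)⟦X⟧} (h : IsSolution Z f) :
    (Fin.cons 1 f : Fin (m + 1) → (CInfty Fq)⟦X⟧) ∈ solutionModule Z := by
  refine ⟨fun i => ?_, by simp, fun i => h.2 i⟩
  refine Fin.cases ?_ (fun i => ?_) i
  · exact one_mem _
  · exact h.1 i

theorem IsStarSolution.snoc_mem {m : ℕ} {Z g : Fin m → (CInfty Fq)⟦X⟧}
    (h : IsStarSolution Z g) :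
    (Fin.snoc g 1 : Fin (m + 1) → (CInfty Fq)⟦X⟧) ∈ starSolutionModule Z := by
  refine ⟨fun i => ?_, by simp, fun i => ?_⟩
  · refine Fin.lastCases ?_ (fun i => ?_) i
    · rw [Fin.snoc_last]
      exact one_mem _
    · rw [Fin.snoc_castSucc]
      exact h.1 i
  · rw [Fin.snoc_castSucc]
    exact h.2 i

/-- A shorter solution is started later, after a run of zeros. The entry `1` is allowed there since
`℘(1) = 0`, and the last `Z` plays no role because it only multiplies the zero initial term. -/
theorem cons_padVec_mem {d k : ℕ} (hk : k ≤ d) {Z : Fin (d + 1) → (CInfty Fq)⟦X⟧}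
    {f : Fin k → (CInfty Fq)⟦X⟧}
    (h : IsSolution (fun i => Z (Fin.castLE hk i).castSucc) f) :
    (Fin.cons 0 (padVec hk f) : Fin (d + 2) → (CInfty Fq)⟦X⟧) ∈ solutionModule Z := by
  refine ⟨fun i => ?_, by simp, fun i => ?_⟩
  · refine Fin.cases (zero_mem _) (fun i => ?_) i
    rw [Fin.cons_succ, padVec]
    split_ifs
    · exact h.1 _
    · exact one_mem _
    · exact zero_mem _
  · rw [Fin.cons_succ]
    obtain ⟨i, hi⟩ := i
    by_cases h1 : d - k < i
    · have hj : i - (d - k) - 1 < k := by omega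
      have hrec := h.2 ⟨i - (d - k) - 1, hj⟩
      -- Reversal in `Fin k` after the shift by `d - k + 1` and reversal in `Fin (d + 1)` both give
      -- `d - i`.
      have hZ : (Fin.castLE hk (Fin.rev ⟨i - (d - k) - 1, hj⟩)).castSucc =
          Fin.rev (⟨i, hi⟩ : Fin (d + 1)) := by
        ext
        simp only [Fin.val_castSucc, Fin.val_castLE, Fin.val_rev]
        omega
      have hv : padVec hk f ⟨i, hi⟩ = f ⟨i - (d - k) - 1, hj⟩ := by
        rw [padVec, dif_pos h1]
      rw [hv, hrec]
      beta_reduce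
      rw [hZ]
      congr 2
      obtain ⟨i, rfl⟩ : ∃ l, i = l + 1 := ⟨i - 1, by omega⟩
      have hc : (Fin.castSucc ⟨i + 1, hi⟩ : Fin (d + 2)) = Fin.succ ⟨i, by omega⟩ := rfl
      rw [hc, Fin.cons_succ, padVec]
      split_ifs with h2 h3
      · have : (Fin.castSucc ⟨i + 1 - (d - k) - 1, hj⟩ : Fin (k + 1)) =
            Fin.succ ⟨i - (d - k) - 1, by omega⟩ := by
          ext
          simp only [Fin.val_castSucc, Fin.val_succ]
          simp only at h2
          omega
        rw [this, Matrix.cons_val_succ]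
      · have : (Fin.castSucc ⟨i + 1 - (d - k) - 1, hj⟩ : Fin (k + 1)) = 0 := by
          ext
          simp only [Fin.val_castSucc, Fin.val_zero]
          simp only at h3
          omega
        rw [this, Matrix.cons_val_zero]
      · simp only at h2 h3
        omega
    · have hp : (Fin.cons 0 (padVec hk f) : Fin (d + 2) → (CInfty Fq)⟦X⟧)
          (Fin.castSucc ⟨i, hi⟩) = 0 := by
        rcases i with _ | i
        · rfl
        · have hc : (Fin.castSucc ⟨i + 1, hi⟩ : Fin (d + 2)) = Fin.succ ⟨i, by omega⟩ := rfl
          rw [hc, Fin.cons_succ, padVec, dif_neg (by simp only; omega),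
            if_neg (by simp only; omega)]
      rw [hp, map_zero, mul_zero, padVec, dif_neg h1]
      split_ifs <;> simp

/-- Mirror image of `cons_padVec_mem`: the zeros now follow the entry `1`, and the last `Z`
multiplies the appended zero. -/
theorem snoc_starPadVec_mem {d k : ℕ} (hk : k ≤ d) {Z : Fin (d + 1) → (CInfty Fq)⟦X⟧}
    {g : Fin k → (CInfty Fq)⟦X⟧}
    (h : IsStarSolution (fun i => Z (Fin.castLE hk i).castSucc) g) :
    (Fin.snoc (starPadVec g : Fin (d + 1) → (CInfty Fq)⟦X⟧) 0 : Fin (d + 2) → (CInfty Fq)⟦X⟧) ∈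
      starSolutionModule Z := by
  refine ⟨fun i => ?_, by simp, fun i => ?_⟩
  · refine Fin.lastCases ?_ (fun i => ?_) i
    · rw [Fin.snoc_last]
      exact zero_mem _
    rw [Fin.snoc_castSucc, starPadVec]
    split_ifs
    · exact h.1 _
    · exact one_mem _
    · exact zero_mem _
  · rw [Fin.snoc_castSucc]
    obtain ⟨i, hi⟩ := i
    by_cases h1 : i < k
    · have hv : (starPadVec g : Fin (d + 1) → (CInfty Fq)⟦X⟧) ⟨i, hi⟩ = g ⟨i, h1⟩ := by
        rw [starPadVec, dif_pos h1]
      rw [hv, h.2 ⟨i, h1⟩]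
      congr 1
      have hc : (Fin.succ ⟨i, hi⟩ : Fin (d + 2)) = Fin.castSucc ⟨i + 1, by omega⟩ := rfl
      rw [hc, Fin.snoc_castSucc, starPadVec]
      split_ifs with h2 h3
      · have : (Fin.succ ⟨i, h1⟩ : Fin (k + 1)) = Fin.castSucc ⟨i + 1, h2⟩ := rfl
        rw [this, Fin.snoc_castSucc]
      · have : (Fin.succ ⟨i, h1⟩ : Fin (k + 1)) = Fin.last k := by
          ext
          exact h3
        rw [this, Fin.snoc_last]
      · simp only at h2 h3
        omega
    · have hp : (Fin.snoc (starPadVec g : Fin (d + 1) → (CInfty Fq)⟦X⟧) 0 :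
          Fin (d + 2) → (CInfty Fq)⟦X⟧) (Fin.succ ⟨i, hi⟩) = 0 := by
        refine Fin.lastCases (motive := fun j => (i + 1 = (j : ℕ)) → (Fin.snoc
          (starPadVec g : Fin (d + 1) → (CInfty Fq)⟦X⟧) 0 : Fin (d + 2) → (CInfty Fq)⟦X⟧) j = 0)
          ?_ (fun j hj => ?_) (Fin.succ ⟨i, hi⟩) rfl
        · intro _
          rw [Fin.snoc_last]
        · rw [Fin.val_castSucc] at hj
          rw [Fin.snoc_castSucc, starPadVec, dif_neg (by omega), if_neg (by omega)]
      rw [hp, mul_zero, starPadVec, dif_neg h1]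
      split_ifs <;> simp

theorem cons_zero_mem_of_mem_monodromyZero {d : ℕ} {Z : Fin (d + 1) → (CInfty Fq)⟦X⟧}
    {F : Fin (d + 1) → (CInfty Fq)⟦X⟧} (hF : F ∈ monodromyZero fun i => Z i.castSucc) :
    (Fin.cons 0 F : Fin (d + 2) → (CInfty Fq)⟦X⟧) ∈ solutionModule Z := by
  induction hF using Submodule.span_induction with
  | mem F h =>
    obtain ⟨k, hk, f, hf, rfl⟩ := h
    exact cons_padVec_mem hk hf
  | zero =>
    convert (solutionModule Z).zero_mem using 1
    ext j : 1
    refine Fin.cases rfl (fun j => rfl) j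
  | add F G _ _ hF hG =>
    convert (solutionModule Z).add_mem hF hG using 1
    ext j : 1
    refine Fin.cases (by simp) (fun j => rfl) j
  | smul a F _ hF =>
    convert (solutionModule Z).smul_mem a hF using 1
    ext j : 1
    refine Fin.cases (by simp) (fun j => rfl) j

theorem snoc_zero_mem_of_mem_starMonodromyZero {d : ℕ} {Z : Fin (d + 1) → (CInfty Fq)⟦X⟧}
    {F : Fin (d + 1) → (CInfty Fq)⟦X⟧} (hF : F ∈ starMonodromyZero fun i => Z i.castSucc) :
    (Fin.snoc F 0 : Fin (d + 2) → (CInfty Fq)⟦X⟧) ∈ starSolutionModule Z := by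
  induction hF using Submodule.span_induction with
  | mem F h =>
    obtain ⟨k, hk, f, hf, rfl⟩ := h
    exact snoc_starPadVec_mem hk hf
  | zero =>
    convert (starSolutionModule Z).zero_mem using 1
    ext j : 1
    refine Fin.lastCases (by simp) (fun j => by simp) j
  | add F G _ _ hF hG =>
    convert (starSolutionModule Z).add_mem hF hG using 1
    ext j : 1
    refine Fin.lastCases (by simp) (fun j => by simp) j
  | smul a F _ hF =>
    convert (starSolutionModule Z).smul_mem a hF using 1
    ext j : 1
    refine Fin.lastCases (by simp) (fun j => by simp) j

/-- The duality between solutions and star solutions: their alternating pairing takes values in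
`𝔽_q[t]`. -/
theorem exists_sum_mul_eq_algebraMap {m : ℕ} {Z : Fin m → (CInfty Fq)⟦X⟧}
    {p s : Fin (m + 1) → (CInfty Fq)⟦X⟧} (hp : p ∈ solutionModule Z)
    (hs : s ∈ starSolutionModule fun i => Z i.rev) :
    ∃ a : Polynomial Fq, ∑ j : Fin (m + 1), (-1) ^ (m - (j : ℕ)) * (s j * p j) =
      algebraMap (Polynomial Fq) (CInfty Fq)⟦X⟧ a := by
  obtain ⟨hpt, hp0, hp⟩ := hp
  obtain ⟨hst, hs0, hs⟩ := hs
  refine IsTate.exists_eq_algebraMap_of_wp_eq_zero (mem_tateSubalgebra.mp (sum_mem fun j _ =>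
    mul_mem (pow_mem (neg_mem (one_mem _)) _) (mul_mem (hst j) (hpt j)))) ?_
  -- Twisted Leibniz rule; the signs are fixed by the twist.
  have hw : wp (∑ j : Fin (m + 1), (-1) ^ (m - (j : ℕ)) * (s j * p j)) =
      ∑ j : Fin (m + 1), (-1) ^ (m - (j : ℕ)) * (s j * wp (p j)) +
        ∑ j : Fin (m + 1), (-1) ^ (m - (j : ℕ)) * (wp (s j) * twist (p j)) := by
    rw [wp, map_sum, ← Finset.sum_sub_distrib, ← Finset.sum_add_distrib]
    refine Finset.sum_congr rfl fun j _ => ?_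
    rw [← mul_add, ← wp_mul, wp]
    simp only [map_mul, map_pow, map_neg, map_one]
    ring
  -- The boundary terms vanish: `j = 0` in the first sum, the last `j` in the second. The index
  -- shift then matches `i.succ` in the first with `i.castSucc` in the second, where the signs are
  -- opposite.
  rw [hw, Fin.sum_univ_succ, Fin.sum_univ_castSucc (n := m), hp0, hs0]
  simp only [mul_zero, zero_mul, zero_add, add_zero, hp, hs]
  rw [← Finset.sum_add_distrib]
  refine Finset.sum_eq_zero fun i _ => ?_
  have hi : m - (i : ℕ) = m - (i + 1 : ℕ) + 1 := by omega
  rw [Fin.val_succ, Fin.val_castSucc, hi, pow_succ]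
  ring

end Systems

/-! ### Lifting branch values to solutions -/

section Branches

variable {Fq : Type*} [Field Fq] [Fintype Fq]

/-- A branch value differs from the value of a representative by that of a monodromy vector. Adding
this vector with a zero in front keeps the initial term `1`, whose multiple `Ω^{-N}` accounts for
the entry `π̃^N`. -/
theorem IsBranch.exists_evalsTo {lam : CInfty Fq} (hlam : lam ≠ 0) {d : ℕ} {n : Fin (d + 1) → ℕ}
    {z : Fin d → CInfty Fq} {L : CInfty Fq →ₗ[Fq] (Fin (d + 1) → CInfty Fq)}
    (hL : IsBranch lam n z L) (w : CInfty Fq) :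
    ∃ p ∈ solutionModule (fun i => Omega lam ^ n i *
        C (Fin.snoc (α := fun _ => CInfty Fq) z w i)),
      ∀ j, EvalsTo ((Omega lam)⁻¹ ^ (∑ i, n i) * p j)
        ((Fin.cons (piTilde lam ^ ∑ i, n i) (L w) : Fin (d + 2) → CInfty Fq) j) := by
  obtain ⟨F, v, ⟨f, hf, rfl⟩, hv, hLv⟩ := hL w
  obtain ⟨G, ⟨G, hG, rfl⟩, hGv⟩ := (Submodule.Quotient.eq _).mp hLv
  have hG' : G ∈ monodromyZero fun i : Fin d =>
      (fun i => Omega lam ^ n i * C (Fin.snoc (α := fun _ => CInfty Fq) z w i)) i.castSucc := by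
    simpa only [Fin.snoc_castSucc, SetLike.mem_coe] using hG
  refine ⟨_, Submodule.add_mem _ hf.cons_mem (cons_zero_mem_of_mem_monodromyZero hG'),
    fun j => ?_⟩
  refine Fin.cases ?_ (fun j => ?_) j
  · simpa using (evalsTo_inv_Omega hlam).pow (∑ i, n i)
  · have h := (hv j).add (hGv j)
    simpa [mul_add] using h

theorem IsStarBranch.exists_evalsTo {lam : CInfty Fq} (hlam : lam ≠ 0) {d : ℕ}
    {n : Fin (d + 1) → ℕ} {z : Fin d → CInfty Fq}
    {L : CInfty Fq →ₗ[Fq] (Fin (d + 1) → CInfty Fq)}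
    (hL : IsStarBranch lam n z L) (w : CInfty Fq) :
    ∃ s ∈ starSolutionModule (fun i => Omega lam ^ n i *
        C (Fin.snoc (α := fun _ => CInfty Fq) z w i)),
      ∀ j, EvalsTo ((Omega lam)⁻¹ ^ (∑ i, n i) * s j)
        ((Fin.snoc (L w) (piTilde lam ^ ∑ i, n i) : Fin (d + 2) → CInfty Fq) j) := by
  obtain ⟨F, v, ⟨f, hf, rfl⟩, hv, hLv⟩ := hL w
  obtain ⟨G, ⟨G, hG, rfl⟩, hGv⟩ := (Submodule.Quotient.eq _).mp hLv
  have hG' : G ∈ starMonodromyZero fun i : Fin d =>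
      (fun i => Omega lam ^ n i * C (Fin.snoc (α := fun _ => CInfty Fq) z w i)) i.castSucc := by
    simpa only [Fin.snoc_castSucc, SetLike.mem_coe] using hG
  refine ⟨_, Submodule.add_mem _ hf.snoc_mem (snoc_zero_mem_of_mem_starMonodromyZero hG'),
    fun j => ?_⟩
  refine Fin.lastCases ?_ (fun j => ?_) j
  · simpa using (evalsTo_inv_Omega hlam).pow (∑ i, n i)
  · have h := (hv j).add (hGv j)
    simpa [mul_add] using h

end Branches

/-! ### The congruence modulo `π̃^{2N} A` -/

theorem mainTheorem5 (Fq : Type*) [Field Fq] [Fintype Fq]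
    (lam : CInfty Fq) (hlam : lam ^ (Fintype.card Fq - 1) = -theta Fq)
    (d : ℕ) (n : Fin (d + 1) → ℕ) (hn : ∀ i, 1 ≤ n i) (z : Fin (d + 1) → CInfty Fq)
    (L : CInfty Fq →ₗ[Fq] (Fin (d + 1) → CInfty Fq))
    (hL : IsBranch lam n (fun i => z i.castSucc) L)
    (Lstar : CInfty Fq →ₗ[Fq] (Fin (d + 1) → CInfty Fq))
    (hLstar : IsStarBranch lam (fun i => n i.rev) (fun i => z i.castSucc.rev) Lstar) :
    ∃ a ∈ ringA Fq,
      (Fin.snoc (negArgs (Lstar (z 0))) (piTilde lam ^ ∑ i, n i) : Fin (d + 2) → CInfty Fq) ⬝ᵥ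
        (Fin.cons (piTilde lam ^ ∑ i, n i) (L (z (Fin.last d))) : Fin (d + 2) → CInfty Fq) =
      piTilde lam ^ (2 * ∑ i, n i) * a := by
  have hlam0 : lam ≠ 0 := by
    rintro rfl
    have h1 : Fintype.card Fq - 1 ≠ 0 := by
      have : 1 < Fintype.card Fq := Fintype.one_lt_card
      omega
    rw [zero_pow h1] at hlam
    exact theta_ne_zero (neg_eq_zero.mp hlam.symm)
  have hsum : ∑ i : Fin (d + 1), n i.rev = ∑ i, n i := Equiv.sum_comp Fin.revPerm n
  have hz : (Fin.snoc (α := fun _ => CInfty Fq) (fun i : Fin d => z i.castSucc)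
      (z (Fin.last d))) = z := by
    ext i : 1
    refine Fin.lastCases (by simp) (fun i => by simp) i
  -- The star data are exactly the reversed data, as the duality requires.
  have hz' : (Fin.snoc (α := fun _ => CInfty Fq) (fun i : Fin d => z i.castSucc.rev) (z 0)) =
      fun i => z i.rev := by
    ext i : 1
    refine Fin.lastCases (by simp) (fun i => by simp) i
  obtain ⟨p, hp, hpv⟩ := hL.exists_evalsTo hlam0 (z (Fin.last d))
  obtain ⟨s, hs, hsv⟩ := hLstar.exists_evalsTo hlam0 (z 0)
  rw [hz] at hp
  rw [hz'] at hs
  rw [hsum] at hsv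
  obtain ⟨a, ha⟩ := exists_sum_mul_eq_algebraMap hp hs
  refine ⟨Polynomial.aeval (theta Fq) a, ?_, ?_⟩
  · rw [ringA, Algebra.adjoin_singleton_eq_range_aeval]
    exact ⟨a, rfl⟩
  have hpair := EvalsTo.sum Finset.univ fun (j : Fin (d + 2)) _ =>
    (evalsTo_C ((-1) ^ (d + 1 - (j : ℕ)))).mul ((hsv j).mul (hpv j))
  have hpoly := ((evalsTo_inv_Omega hlam0).pow (2 * ∑ i, n i)).poly_smul a
  -- The two factors `Ω^{-N}` come out of the pairing, leaving the polynomial `a`.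
  have heq : ∑ j : Fin (d + 2), C ((-1 : CInfty Fq) ^ (d + 1 - (j : ℕ))) *
      ((Omega lam)⁻¹ ^ (∑ i, n i) * s j * ((Omega lam)⁻¹ ^ (∑ i, n i) * p j)) =
      a • (Omega lam)⁻¹ ^ (2 * ∑ i, n i) := by
    rw [Algebra.smul_def, ← ha, Finset.sum_mul]
    refine Finset.sum_congr rfl fun j _ => ?_
    rw [two_mul, pow_add, map_pow, map_neg, map_one]
    ring
  rw [heq] at hpair
  rw [mul_comm, ← hpair.unique hpoly, dotProduct]
  refine Finset.sum_congr rfl fun j _ => ?_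
  rw [← mul_assoc]
  congr 1
  -- The duality sign `(-1)^(d+1-j)` is the one built into `negArgs` for `j ≤ d`, and is `1` at the
  -- final entry `π̃^N`.
  refine Fin.lastCases (by simp) (fun j => by simp [negArgs]) j
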